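/- \textbf{Setting.} For a plane graph $\Gamma$ the radial graph $R(\Gamma)$ is the plane bipartite graph on the vertices and faces of $\Gamma$ in which a vertex is joined to the faces on whose boundary it lies; all its regions are $4$-cycles, and two vertices of $\Gamma$ are adjacent in $\Gamma$ if and only if they are opposite corners of a region of $R(\Gamma)$. \textbf{The algorithm.} The input is a tuple $T=(t_1,\dots,t_k)$ of integers $t_i\ge 4$. Start with the radial graph of the tetrahedron, i.e. the cube with vertices $v_1,f_1,\dots,v_4,f_4$ whose regions are the $4$-cycles $v_1f_1v_2f_3$, $v_1f_1v_3f_2$, $v_1f_2v_4f_3$, $v_2f_1v_3f_4$, $v_2f_3v_4f_4$, $v_3f_2v_4f_4$, and with the labels $a=v_2$, $A=f_2$, $b=v_4$, $B=f_4$, $c=v_3$, $C=f_3$. The transformation $\mathcal Z$ acts on the two adjacent regions $aCbB$ and $bAcB$: it deletes their common side $bB$ and inserts new vertices $d=v_{n+1}$, $D=f_{n+1}$ (where $v_1,f_1,\dots,v_n,f_n$ are the vertices present) and the edges $dB,dC,dD,bD,cD$, so that the two regions are replaced by the four regions $aCdB$, $bCdD$, $bAcD$, $cBdD$. For $i=1,\dots,k$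 in turn, $\mathcal Z$ is applied $t_i-3$ times. After each of the first $t_i-4$ of these applications one relabels $(a,A,b,B,c,C):=(b,B,d,D,c,C)$, and after the last one $(a,A,b,B,c,C):=(c,C,d,D,b,B)$; the right-hand sides refer to the labels before relabelling and to the vertices $d,D$ just inserted. The output $G=P(T)$ is the graph on the vertices $v_1,v_2,\dots$ of the final quadrangulation in which two distinct vertices are adjacent if and only if they are opposite corners of a region. For $1\le i\le k$, let $u_i$ be the vertex labelled $c$ when the processing of $t_i$ begins. \textbf{Lemma.} Let $T=(t_1,\dots,t_k)$ be a tuple of integers $t_i\ge 4$, let $G=P(T)$ and let $u_1,\dots,u_k$ be as above. Then $u_1,\dots,u_k$ are distinct, $\deg_G(u_i)=t_i$ for $1\le i\le k$, and all other vertices of $G$ have degree $3$. Moreover: \begin{itemize} \item for each $1\le i\le k-1$, $u_i$ is adjacent to $u_{i+1}$; \item for each $i$, $u_i$ is adjacent to at most one $u_j$ with $j\ge i+2$; \item for $1\le i\le k-2$, $u_i$ is adjacent to $u_{i+2}$ if and only if $t_{i+1}=5$; \item for $1\le i\le k-3$, $u_i$ is adjacent to $u_{i+3}$ if and only if $t_{i+1}=t_{i+2}=4$;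 \item if neither ($i\le k-2$ and $t_{i+1}=5$) nor ($i\le k-3$ and $t_{i+1}=t_{i+2}=4$) holds, then $u_i$ is not adjacent to any $u_j$ with $j\ge i+2$. \end{itemize} -/

import Mathlib

namespace RadialAlgorithm

/-- A region of the radial graph (vertex-face graph) of a plane graph `Γ` with vertices
`v₁, v₂, …` and faces `f₁, f₂, …`.  Every region of the radial graph is bounded by a `4`-cycle
`v_x f_X v_y f_Y`, and this region is recorded as its two pairs of opposite corners,
`(s(x, y), s(X, Y))`.  The four sides of the region are the edges `v_x f_X`, `f_X v_y`,
`v_y f_Y`, `f_Y v_x` of the radial graph. -/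
abbrev Region := Sym2 ℕ × Sym2 ℕ

/-- A stage of the algorithm: a plane quadrangulation with vertices `v₁, f₁, …, vₙ, fₙ`
(`n = order`), given by its set of regions, so that its edges are the sides of the regions;
and the current labels.  The lower-case labels `a`, `b`, `c` are the vertices `v_a`, `v_b`, `v_c`,
the upper-case labels `A`, `B`, `C` are the vertices `f_A`, `f_B`, `f_C`. -/
structure Stage where
  order : ℕ
  regions : Finset Region
  a : ℕ
  b : ℕ
  c : ℕ
  A : ℕ
  B : ℕ
  C : ℕ

/-- The cube, radial graph of the tetrahedron: `f₁, f₂, f₃, f₄` are the triangles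
`v₁v₂v₃`, `v₁v₃v₄`, `v₁v₂v₄`, `v₂v₃v₄`.  The labels are
`a = v₂`, `A = f₂`, `c = v₃`, `C = f₃`, `b = v₄`, `B = f₄`. -/
def cube : Stage where
  order := 4
  regions :=
    { (s(1, 2), s(1, 3)), (s(1, 3), s(1, 2)), (s(1, 4), s(2, 3)),
      (s(2, 3), s(1, 4)), (s(2, 4), s(3, 4)), (s(3, 4), s(2, 4)) }
  a := 2
  b := 4
  c := 3
  A := 2
  B := 4
  C := 3

/-- The transformation `𝒵`.  It acts inside the hexagon `a C b A c B` formed by the two adjacent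
regions `a C b B` and `b A c B`: their common side `bB` is deleted, new vertices `d = vₙ₊₁`
and `D = fₙ₊₁` are inserted, and the edges `dB`, `dC`, `dD`, `Db`, `Dc` are added.  The hexagon is
then divided into the four regions `a C d B`, `b C d D`, `b A c D`, `c B d D`.  For the plane graph
and for its dual this is the edge splitting `- ab + d + da + db + dc`,
respectively `- AB + D + DA + DB + DC`. -/
def Stage.transform (s : Stage) : Stage :=
  { s with
    order := s.order + 1
    regions :=
      (s.regions \ {(s(s.a, s.b), s(s.B, s.C)), (s(s.b, s.c), s(s.A, s.B))}) ∪
        { (s(s.a, s.order + 1), s(s.B, s.C)),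
          (s(s.b, s.order + 1), s(s.C, s.order + 1)),
          (s(s.b, s.c), s(s.A, s.order + 1)),
          (s(s.c, s.order + 1), s(s.B, s.order + 1)) } }

/-- First relabelling, after a transformation: `c, C` are kept, the old `b, B` become `a, A`, and
the vertices `d, D` just inserted become `b, B`. -/
def Stage.relabelKeep (s : Stage) : Stage :=
  { s with a := s.b, A := s.B, b := s.order, B := s.order }

/-- Second relabelling, after a transformation: the old `c, C` become `a, A`, the old `b, B` become
`c, C`, and the vertices `d, D` just inserted become `b, B`. -/
def Stage.relabelNext (s : Stage) : Stage :=
  { s with a := s.c, A := s.C, c := s.b, C := s.B, b := s.order, B := s.order }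

/-- Processing one entry `t ≥ 4` of the input: `𝒵` is applied `t - 3` times, raising the degree of
`c` and of `C` from `3` to `t`; each of the first `t - 4` applications is followed by the first
relabelling, the last one by the second relabelling. -/
def Stage.process (s : Stage) (t : ℕ) : Stage :=
  ((fun r : Stage => r.transform.relabelKeep)^[t - 4] s).transform.relabelNext

/-- The stage reached from the cube after all the entries of the tuple have been processed. -/
def run (T : List ℕ) : Stage := T.foldl Stage.process cube

/-- The vertex set `v₁, …, vₙ` of the output. -/
abbrev Vertex (T : List ℕ) : Type := { x : ℕ // x ∈ Finset.Icc 1 (run T).order }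

/-- The output `P(T)` of the algorithm, recovered from its radial graph: two distinct vertices are
adjacent if and only if they are opposite corners of some region of the radial graph. -/
def output (T : List ℕ) : SimpleGraph (Vertex T) where
  Adj x y := x ≠ y ∧ ∃ r ∈ (run T).regions, r.1 = s(x.1, y.1)
  symm := ⟨fun _ _ h => ⟨h.1.symm, h.2.imp fun _ hr => ⟨hr.1, hr.2.trans Sym2.eq_swap⟩⟩⟩
  loopless := ⟨fun _ h => h.1 rfl⟩

instance (T : List ℕ) : DecidableRel (output T).Adj := fun x y =>
  inferInstanceAs (Decidable (x ≠ y ∧ ∃ r ∈ (run T).regions, r.1 = s(x.1, y.1)))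

/-- The labels `b`, `c` always name vertices that are present. -/
def Stage.Valid (s : Stage) : Prop :=
  s.b ∈ Finset.Icc 1 s.order ∧ s.c ∈ Finset.Icc 1 s.order

theorem Stage.iterate_order_le (s : Stage) (n : ℕ) :
    s.order ≤ ((fun r : Stage => r.transform.relabelKeep)^[n] s).order := by
  induction n with
  | zero => exact le_rfl
  | succ n ih =>
    rw [Function.iterate_succ_apply']
    exact ih.trans (Nat.le_succ _)

theorem Stage.Valid.iterate {s : Stage} (h : s.Valid) (n : ℕ) :
    ((fun r : Stage => r.transform.relabelKeep)^[n] s).Valid := by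
  induction n with
  | zero => exact h
  | succ n ih =>
    rw [Function.iterate_succ_apply']
    simp only [Valid, transform, relabelKeep, Finset.mem_Icc] at ih ⊢
    omega

theorem Stage.order_le_process (s : Stage) (t : ℕ) : s.order ≤ (s.process t).order :=
  (s.iterate_order_le (t - 4)).trans (Nat.le_succ _)

theorem Stage.Valid.process {s : Stage} (h : s.Valid) (t : ℕ) : (s.process t).Valid := by
  have h' := h.iterate (t - 4)
  simp only [Valid, Stage.process, transform, relabelNext, Finset.mem_Icc] at h' ⊢
  omega

theorem Stage.order_le_foldl (T : List ℕ) (s : Stage) :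
    s.order ≤ (T.foldl Stage.process s).order := by
  induction T generalizing s with
  | nil => exact le_rfl
  | cons t T ih => exact (s.order_le_process t).trans (ih _)

theorem Stage.Valid.foldl (T : List ℕ) {s : Stage} (h : s.Valid) :
    (T.foldl Stage.process s).Valid := by
  induction T generalizing s with
  | nil => exact h
  | cons t T ih => exact ih (h.process t)

theorem run_take_c_mem (T : List ℕ) (i : ℕ) :
    (run (T.take i)).c ∈ Finset.Icc 1 (run T).order := by
  have h0 : cube.Valid := by simp [Stage.Valid, cube]
  have h1 : (run (T.take i)).Valid := h0.foldl _
  have h2 : (run (T.take i)).order ≤ (run T).order := by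
    have : run T = (T.drop i).foldl Stage.process (run (T.take i)) := by
      rw [run, run, ← List.foldl_append, List.take_append_drop]
    rw [this]
    exact Stage.order_le_foldl _ _
  exact Finset.Icc_subset_Icc_right h2 h1.2

/-- The vertex `u_i` of the output, whose degree the algorithm raises to the `i`-th entry of the
tuple: the vertex labelled `c` when the processing of that entry begins (entries are numbered
from `0`). -/
def bigVertex (T : List ℕ) (i : Fin T.length) : Vertex T :=
  ⟨(run (T.take i)).c, run_take_c_mem T i⟩

end RadialAlgorithm

/-!
Only the graph formed by the lower-case corners matters.  On it `𝒵` is the edge splitting that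
deletes `ab` and joins a new vertex `d` to `a`, `b` and `c` (`Stage.Good.mem_edges_transform`).
This relies on an invariant (`Stage.Good`): `abc` is a triangle, the two regions on which `𝒵` acts are
present, and distinct regions have distinct pairs of lower-case corners, so that deleting a region
does delete the corresponding edge.  Hence a transformation raises the degree of `c` by one, creates
a vertex of degree `3`, and changes no other degree.  The vertex that becomes `c` for the next entry
is the current `b`, which has degree `3` and was never `c` before; this gives the degrees.

For adjacencies two facts suffice.  After a transformation `b` is the new vertex, so a later step
deletes only edges at vertices inserted later or at the last one: adjacency of two present vertices
is final unless they are `a` and `b` (`Stage.Reach.mem_edges_iff`).  And a vertex without label gets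
no further neighbours (`Stage.Reach.notMem_edges_of_unlabelled`).

When the processing of `t = t_{i+1}` begins, `a = u_i` and `c = u_{i+1}`.  The first transformation
deletes `ab` and joins `a` to the first inserted vertex; then `a` loses its label.  At the end, the
new `c`, which is `u_{i+2}`, is the old `b` if `t = 4`, the first inserted vertex if `t = 5`, and a
later one if `t > 5`: so `u_i` is joined to `u_{i+2}` exactly if `t = 5`.  The new `b` is the last
inserted vertex, joined to `u_i` exactly if `t = 4`, and it becomes `u_{i+3}` if the next entry
is `4`.  Every other later big vertex is inserted after `u_i` has lost its label.
-/

namespace RadialAlgorithm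

namespace Stage

/-! ### The invariant -/

/-- The edges of the plane graph whose radial graph is the current quadrangulation: the pairs of
opposite lower-case corners of its regions. -/
def edges (s : Stage) : Finset (Sym2 ℕ) := s.regions.image Prod.fst

/-- The invariant of the algorithm.  Distinct regions belong to distinct edges (so that deleting
the region of `ab` deletes the edge `ab`), the two regions on which `𝒵` acts are present, `abc` is a
triangle, and all edges are proper pairs of vertices that are present. -/
structure Good (s : Stage) : Prop where
  injOn : Set.InjOn Prod.fst (s.regions : Set Region)
  region_ab : (s(s.a, s.b), s(s.B, s.C)) ∈ s.regions
  region_bc : (s(s.b, s.c), s(s.A, s.B)) ∈ s.regions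
  edge_ac : s(s.a, s.c) ∈ s.edges
  proper : ∀ x y, s(x, y) ∈ s.edges → (1 ≤ x ∧ x ≤ s.order) ∧ x ≠ y

/-- One application of `𝒵`, followed by either of the two relabellings. -/
def Step (s s' : Stage) : Prop :=
  s' = s.transform.relabelKeep ∨ s' = s.transform.relabelNext

theorem good_cube : cube.Good where
  injOn := by
    have h : ∀ x ∈ cube.regions, ∀ y ∈ cube.regions, x.1 = y.1 → x = y := by decide
    exact fun x hx y hy => h x hx y hy
  region_ab := by decide
  region_bc := by decide
  edge_ac := by decide
  proper := by
    intro x y h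
    simp only [edges, cube, Finset.mem_image, Finset.mem_insert, Finset.mem_singleton] at h ⊢
    obtain ⟨r, hr, hxy⟩ := h
    rcases hr with rfl | rfl | rfl | rfl | rfl | rfl <;>
      simp only [Sym2.eq_iff] at hxy <;> omega

section

variable {s s' : Stage}

theorem mem_edges {e : Sym2 ℕ} : e ∈ s.edges ↔ ∃ r ∈ s.regions, r.1 = e := by
  simp [edges]

theorem Good.edge_ab (h : s.Good) : s(s.a, s.b) ∈ s.edges := mem_edges.2 ⟨_, h.region_ab, rfl⟩

theorem Good.edge_bc (h : s.Good) : s(s.b, s.c) ∈ s.edges := mem_edges.2 ⟨_, h.region_bc, rfl⟩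

theorem Good.a_ne_b (h : s.Good) : s.a ≠ s.b := (h.proper _ _ h.edge_ab).2

theorem Good.b_ne_c (h : s.Good) : s.b ≠ s.c := (h.proper _ _ h.edge_bc).2

theorem Good.a_ne_c (h : s.Good) : s.a ≠ s.c := (h.proper _ _ h.edge_ac).2

theorem Good.a_bounds (h : s.Good) : 1 ≤ s.a ∧ s.a ≤ s.order := (h.proper _ _ h.edge_ab).1

theorem Good.b_bounds (h : s.Good) : 1 ≤ s.b ∧ s.b ≤ s.order := (h.proper _ _ h.edge_bc).1

theorem Good.c_bounds (h : s.Good) : 1 ≤ s.c ∧ s.c ≤ s.order :=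
  (h.proper s.c s.a (Sym2.eq_swap ▸ h.edge_ac)).1

theorem Good.proper_right (h : s.Good) {x y : ℕ} (hxy : s(x, y) ∈ s.edges) :
    1 ≤ y ∧ y ≤ s.order :=
  (h.proper y x (Sym2.eq_swap ▸ hxy)).1

/-! ### Edge splitting -/

theorem Good.mem_regions_transform (h : s.Good) (r : Region) :
    r ∈ s.transform.regions ↔
      (r ∈ s.regions ∧ r.1 ≠ s(s.a, s.b) ∧ r.1 ≠ s(s.b, s.c)) ∨
      r = (s(s.a, s.order + 1), s(s.B, s.C)) ∨
      r = (s(s.b, s.order + 1), s(s.C, s.order + 1)) ∨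
      r = (s(s.b, s.c), s(s.A, s.order + 1)) ∨
      r = (s(s.c, s.order + 1), s(s.B, s.order + 1)) := by
  have h1 : r ∈ s.regions → (r = (s(s.a, s.b), s(s.B, s.C)) ↔ r.1 = s(s.a, s.b)) := fun hr =>
    ⟨fun e => by rw [e], fun e => h.injOn hr h.region_ab e⟩
  have h2 : r ∈ s.regions → (r = (s(s.b, s.c), s(s.A, s.B)) ↔ r.1 = s(s.b, s.c)) := fun hr =>
    ⟨fun e => by rw [e], fun e => h.injOn hr h.region_bc e⟩
  simp only [transform, Finset.mem_union, Finset.mem_sdiff, Finset.mem_insert,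
    Finset.mem_singleton, not_or]
  refine or_congr_left (and_congr_right fun hr => ?_)
  rw [h1 hr, h2 hr]

/-- On the graph, `𝒵` is the edge splitting `- ab + d + da + db + dc`. -/
theorem Good.mem_edges_transform (h : s.Good) (e : Sym2 ℕ) :
    e ∈ s.transform.edges ↔ (e ∈ s.edges ∧ e ≠ s(s.a, s.b)) ∨
      e = s(s.a, s.order + 1) ∨ e = s(s.b, s.order + 1) ∨ e = s(s.c, s.order + 1) := by
  have hbc : s(s.b, s.c) ≠ s(s.a, s.b) := by
    have := h.a_ne_c; have := h.b_ne_c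
    simp only [ne_eq, Sym2.eq_iff]; omega
  have he := h.edge_bc
  simp only [mem_edges (s := s.transform), h.mem_regions_transform]
  constructor
  · rintro ⟨r, ⟨hr, h1, -⟩ | rfl | rfl | rfl | rfl, rfl⟩
    · exact Or.inl ⟨mem_edges.2 ⟨r, hr, rfl⟩, h1⟩
    · simp
    · simp
    · exact Or.inl ⟨he, hbc⟩
    · simp
  · rintro (⟨h1, h2⟩ | rfl | rfl | rfl)
    · by_cases hb : e = s(s.b, s.c)
      · exact ⟨_, Or.inr (Or.inr (Or.inr (Or.inl rfl))), hb.symm⟩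
      · obtain ⟨r, hr, rfl⟩ := mem_edges.1 h1
        exact ⟨r, Or.inl ⟨hr, h2, hb⟩, rfl⟩
    · exact ⟨_, Or.inr (Or.inl rfl), rfl⟩
    · exact ⟨_, Or.inr (Or.inr (Or.inl rfl)), rfl⟩
    · exact ⟨_, Or.inr (Or.inr (Or.inr (Or.inr rfl))), rfl⟩

theorem Good.injOn_transform (h : s.Good) :
    Set.InjOn Prod.fst (s.transform.regions : Set Region) := by
  have hab := h.a_ne_b
  have hac := h.a_ne_c
  have hbc := h.b_ne_c
  have ha := h.a_bounds
  have hb := h.b_bounds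
  have hc := h.c_bounds
  have hnew : ∀ r ∈ s.regions, ∀ x, r.1 ≠ s(x, s.order + 1) := by
    intro r hr x hx
    have := h.proper_right (mem_edges.2 ⟨r, hr, hx⟩)
    omega
  intro r hr q hq hrq
  rw [Finset.mem_coe, h.mem_regions_transform] at hr hq
  rcases hr with ⟨hr, hr1, hr2⟩ | rfl | rfl | rfl | rfl <;>
  rcases hq with ⟨hq, hq1, hq2⟩ | rfl | rfl | rfl | rfl <;>
  first
  | rfl
  | exact h.injOn hr hq hrq
  | exact absurd hrq (hnew _ hr _)
  | exact absurd hrq.symm (hnew _ hq _)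
  | exact absurd hrq hr2
  | exact absurd hrq.symm hq2
  | (exfalso; simp only [Sym2.eq_iff] at hrq; omega)

theorem Step.order_eq (hs : s.Step s') : s'.order = s.order + 1 := by
  rcases hs with rfl | rfl <;> rfl

theorem Step.b_eq (hs : s.Step s') : s'.b = s.order + 1 := by
  rcases hs with rfl | rfl <;> rfl

theorem Step.a_c_eq (hs : s.Step s') :
    s'.a = s.b ∧ s'.c = s.c ∨ s'.a = s.c ∧ s'.c = s.b := by
  rcases hs with rfl | rfl
  · exact Or.inl ⟨rfl, rfl⟩
  · exact Or.inr ⟨rfl, rfl⟩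

theorem Step.mem_edges (hs : s.Step s') (h : s.Good) (e : Sym2 ℕ) :
    e ∈ s'.edges ↔ (e ∈ s.edges ∧ e ≠ s(s.a, s.b)) ∨
      e = s(s.a, s.order + 1) ∨ e = s(s.b, s.order + 1) ∨ e = s(s.c, s.order + 1) := by
  rw [← h.mem_edges_transform]
  rcases hs with rfl | rfl <;> rfl

theorem Step.good (hs : s.Step s') (h : s.Good) : s'.Good where
  injOn := by
    have := h.injOn_transform
    rcases hs with rfl | rfl <;> exact this
  region_ab := by
    have := h.mem_regions_transform
    rcases hs with rfl | rfl
    · refine (this _).2 (Or.inr (Or.inr (Or.inl ?_)))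
      simp [relabelKeep, transform, Sym2.eq_swap]
    · refine (this _).2 (Or.inr (Or.inr (Or.inr (Or.inr ?_))))
      simp [relabelNext, transform, Sym2.eq_swap]
  region_bc := by
    have := h.mem_regions_transform
    rcases hs with rfl | rfl
    · refine (this _).2 (Or.inr (Or.inr (Or.inr (Or.inr ?_))))
      simp [relabelKeep, transform, Sym2.eq_swap]
    · refine (this _).2 (Or.inr (Or.inr (Or.inl ?_)))
      simp [relabelNext, transform, Sym2.eq_swap]
  edge_ac := by
    have h1 : s(s.b, s.c) ∈ s'.edges := by
      refine (hs.mem_edges h _).2 (Or.inl ⟨h.edge_bc, ?_⟩)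
      have := h.a_ne_c; have := h.b_ne_c
      simp only [ne_eq, Sym2.eq_iff]; omega
    rcases hs.a_c_eq with ⟨ha, hc⟩ | ⟨ha, hc⟩ <;> rw [ha, hc]
    · exact h1
    · rwa [Sym2.eq_swap]
  proper := by
    intro x y hxy
    have ha := h.a_bounds
    have hb := h.b_bounds
    have hc := h.c_bounds
    rw [hs.order_eq]
    rcases (hs.mem_edges h _).1 hxy with ⟨h1, -⟩ | h1 | h1 | h1
    · have := h.proper _ _ h1
      omega
    all_goals
      simp only [Sym2.eq_iff] at h1
      omega

/-! ### Degrees -/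

/-- The finset of neighbours of the vertex `x`. -/
def nbhd (s : Stage) (x : ℕ) : Finset ℕ :=
  (Finset.Icc 1 s.order).filter fun y => s(x, y) ∈ s.edges

/-- The number of neighbours of the vertex `x`. -/
def degree (s : Stage) (x : ℕ) : ℕ := (s.nbhd x).card

theorem Good.mem_nbhd (h : s.Good) {x y : ℕ} : y ∈ s.nbhd x ↔ s(x, y) ∈ s.edges := by
  rw [nbhd, Finset.mem_filter, Finset.mem_Icc, and_iff_right_iff_imp]
  exact h.proper_right

theorem Good.degree_eq_card (h : s.Good) {x : ℕ} {N : Finset ℕ}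
    (hN : ∀ y, y ∈ N ↔ s(x, y) ∈ s.edges) : s.degree x = N.card :=
  congrArg Finset.card (Finset.ext fun y => by rw [hN, h.mem_nbhd])

theorem Step.degree_new (hs : s.Step s') (h : s.Good) : s'.degree (s.order + 1) = 3 := by
  have hab := h.a_ne_b
  have hac := h.a_ne_c
  have hbc := h.b_ne_c
  rw [(hs.good h).degree_eq_card (N := {s.a, s.b, s.c}), Finset.card_eq_three.2
    ⟨_, _, _, hab, hac, hbc, rfl⟩]
  intro y
  have h1 : s(s.order + 1, y) ∉ s.edges := fun h1 => by
    have := h.proper _ _ h1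
    omega
  rw [hs.mem_edges h]
  simp only [h1, Finset.mem_insert, Finset.mem_singleton, Sym2.eq_iff]
  grind

theorem Step.degree_c (hs : s.Step s') (h : s.Good) : s'.degree s.c = s.degree s.c + 1 := by
  have hac := h.a_ne_c
  have hbc := h.b_ne_c
  have hc := h.c_bounds
  have hd : s.order + 1 ∉ s.nbhd s.c := fun hd => by
    have := h.proper_right (h.mem_nbhd.1 hd)
    omega
  rw [(hs.good h).degree_eq_card (N := insert (s.order + 1) (s.nbhd s.c)),
    Finset.card_insert_of_notMem hd]
  · rfl
  intro y
  rw [hs.mem_edges h, Finset.mem_insert, h.mem_nbhd]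
  simp only [ne_eq, Sym2.eq_iff]
  grind

/-- The two ends of the deleted edge `ab` get the new vertex in exchange for each other. -/
theorem Step.degree_of_ne (hs : s.Step s') (h : s.Good) {x : ℕ} (hx : x ≤ s.order)
    (hxc : x ≠ s.c) : s'.degree x = s.degree x := by
  have hab := h.a_ne_b
  have ha := h.a_bounds
  have hb := h.b_bounds
  have hd : s.order + 1 ∉ s.nbhd x := fun hd => by
    have := h.proper_right (h.mem_nbhd.1 hd)
    omega
  have exchange : ∀ z ∈ s.nbhd x,
      (insert (s.order + 1) ((s.nbhd x).erase z)).card = s.degree x := fun z hz => by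
    rw [Finset.card_insert_of_notMem fun h' => hd (Finset.mem_of_mem_erase h'),
      Finset.card_erase_add_one hz]
    rfl
  by_cases hxa : x = s.a
  · subst hxa
    rw [← exchange s.b (h.mem_nbhd.2 h.edge_ab)]
    refine (hs.good h).degree_eq_card fun y => ?_
    rw [hs.mem_edges h, Finset.mem_insert, Finset.mem_erase, h.mem_nbhd]
    simp only [ne_eq, Sym2.eq_iff]
    grind
  by_cases hxb : x = s.b
  · subst hxb
    rw [← exchange s.a (h.mem_nbhd.2 (Sym2.eq_swap ▸ h.edge_ab))]
    refine (hs.good h).degree_eq_card fun y => ?_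
    rw [hs.mem_edges h, Finset.mem_insert, Finset.mem_erase, h.mem_nbhd]
    simp only [ne_eq, Sym2.eq_iff]
    grind
  · refine (hs.good h).degree_eq_card (N := s.nbhd x) fun y => ?_
    rw [hs.mem_edges h, h.mem_nbhd]
    simp only [ne_eq, Sym2.eq_iff]
    grind

end

/-! ### Persistence of adjacency -/

/-- `s'` is obtained from `s` by some number of steps. -/
abbrev Reach : Stage → Stage → Prop := Relation.ReflTransGen Step

section

variable {s s' : Stage}

theorem Reach.good (hr : s.Reach s') (h : s.Good) : s'.Good := by
  induction hr with
  | refl => exact h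
  | tail _ hs ih => exact hs.good ih

theorem Reach.order_le (hr : s.Reach s') : s.order ≤ s'.order := by
  induction hr with
  | refl => exact le_rfl
  | tail _ hs ih => rw [hs.order_eq]; omega

/-- Adjacency of two vertices that are present never changes again unless the vertices are those
labelled `a` and `b`: every later deletion concerns an edge at the vertex inserted last. -/
theorem Reach.mem_edges_iff (hr : s.Reach s') (h : s.Good) {x y : ℕ} (hx : x ≤ s.order)
    (hy : y ≤ s.order) (hxy : s(x, y) ≠ s(s.a, s.b)) :
    s(x, y) ∈ s'.edges ↔ s(x, y) ∈ s.edges := by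
  induction hr using Relation.ReflTransGen.head_induction_on with
  | refl => rfl
  | @head s s₁ hs _ ih =>
    have ho := hs.order_eq
    have hb := hs.b_eq
    rw [ih (hs.good h) (by omega) (by omega) (by simp only [ne_eq, Sym2.eq_iff]; omega),
      hs.mem_edges h]
    simp only [Sym2.eq_iff] at hxy ⊢
    grind

theorem Step.a_b_notMem_edges (hs : s.Step s') (h : s.Good) : s(s.a, s.b) ∉ s'.edges := by
  have := h.a_bounds
  have := h.b_bounds
  rw [hs.mem_edges h]
  simp only [Sym2.eq_iff]
  grind

/-- A vertex without label has got all its neighbours. -/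
theorem Reach.notMem_edges_of_unlabelled (hr : s.Reach s') (h : s.Good) {x y : ℕ}
    (hx : x ≤ s.order) (ha : x ≠ s.a) (hb : x ≠ s.b) (hc : x ≠ s.c) (hy : s.order < y) :
    s(x, y) ∉ s'.edges := by
  induction hr using Relation.ReflTransGen.head_induction_on with
  | refl => exact fun hxy => by have := h.proper_right hxy; omega
  | @head s s₁ hs hr ih =>
    have ho := hs.order_eq
    have hb' := hs.b_eq
    have hac := hs.a_c_eq
    by_cases hy' : y = s.order + 1
    · rw [Reach.mem_edges_iff hr (hs.good h) (by omega) (by omega)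
        (by simp only [ne_eq, Sym2.eq_iff]; omega), hs.mem_edges h]
      have : s(x, y) ∉ s.edges := fun hxy => by have := h.proper_right hxy; omega
      simp only [Sym2.eq_iff]
      grind
    · exact ih (hs.good h) (by omega) (by omega) (by omega) (by omega) (by omega)

end

/-! ### Processing one entry -/

section

variable (s : Stage)

/-- The stage after `n` transformations, each followed by the first relabelling. -/
def keep (n : ℕ) : Stage := (fun r : Stage => r.transform.relabelKeep)^[n] s

theorem keep_succ (n : ℕ) : s.keep (n + 1) = (s.keep n).transform.relabelKeep :=
  Function.iterate_succ_apply' ..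

theorem step_keep (n : ℕ) : (s.keep n).Step (s.keep (n + 1)) := Or.inl (s.keep_succ n)

theorem step_keep_one : s.Step (s.keep 1) := s.step_keep 0

theorem keep_c (n : ℕ) : (s.keep n).c = s.c := by
  induction n with
  | zero => rfl
  | succ n ih => rw [keep_succ]; exact ih

theorem keep_order (n : ℕ) : (s.keep n).order = s.order + n := by
  induction n with
  | zero => rfl
  | succ n ih => rw [(s.step_keep n).order_eq, ih, Nat.add_assoc]

theorem keep_succ_b (n : ℕ) : (s.keep (n + 1)).b = s.order + n + 1 := by
  rw [(s.step_keep n).b_eq, keep_order]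

theorem reach_keep_of_le {m n : ℕ} (h : m ≤ n) : (s.keep m).Reach (s.keep n) := by
  induction n, h using Nat.le_induction with
  | base => exact .refl
  | succ n _ ih => exact ih.tail (s.step_keep n)

theorem step_process (t : ℕ) : (s.keep (t - 4)).Step (s.process t) := Or.inr rfl

theorem reach_process_of_le {m t : ℕ} (h : m ≤ t - 4) : (s.keep m).Reach (s.process t) :=
  (s.reach_keep_of_le h).tail (s.step_process t)

theorem reach_process (t : ℕ) : s.Reach (s.process t) := s.reach_process_of_le (Nat.zero_le _)

theorem process_order (t : ℕ) : (s.process t).order = s.order + (t - 4) + 1 := by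
  rw [(s.step_process t).order_eq, keep_order]

theorem process_a (t : ℕ) : (s.process t).a = s.c := s.keep_c (t - 4)

theorem process_b (t : ℕ) : (s.process t).b = s.order + (t - 4) + 1 := by
  rw [(s.step_process t).b_eq, keep_order]

theorem process_c (t : ℕ) : (s.process t).c = (s.keep (t - 4)).b := rfl

theorem process_four_c : (s.process 4).c = s.b := rfl

theorem process_c_of_four_lt {t : ℕ} (ht : 4 < t) : (s.process t).c = s.order + (t - 4) := by
  obtain ⟨n, rfl⟩ : ∃ n, t = n + 1 + 4 := ⟨t - 5, by omega⟩
  rw [process_c, Nat.add_sub_cancel, keep_succ_b, Nat.add_assoc]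

variable {s}

theorem Good.degree_keep (h : s.Good) (n : ℕ) :
    (s.keep n).degree s.c = s.degree s.c + n ∧
    (∀ x ≤ s.order, x ≠ s.c → (s.keep n).degree x = s.degree x) ∧
    ∀ x, s.order < x → x ≤ s.order + n → (s.keep n).degree x = 3 := by
  induction n with
  | zero => exact ⟨rfl, fun _ _ _ => rfl, fun x h1 h2 => by omega⟩
  | succ n ih =>
    obtain ⟨ih1, ih2, ih3⟩ := ih
    have hg : (s.keep n).Good := (s.reach_keep_of_le n.zero_le).good h
    have hs := s.step_keep n
    have ho := s.keep_order n
    have hc := s.keep_c n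
    have hcb := h.c_bounds
    refine ⟨?_, fun x hx hxc => ?_, fun x hx hx' => ?_⟩
    · have := hs.degree_c hg
      rw [hc] at this
      omega
    · rw [hs.degree_of_ne hg (by omega) (by omega), ih2 x hx hxc]
    · by_cases hxn : x = s.order + n + 1
      · rw [hxn, ← ho, hs.degree_new hg]
      · rw [hs.degree_of_ne hg (by omega) (by omega), ih3 x hx (by omega)]

theorem Good.degree_process_c (h : s.Good) {t : ℕ} (ht : 4 ≤ t) :
    (s.process t).degree s.c = s.degree s.c + (t - 3) := by
  have hg : (s.keep (t - 4)).Good := (s.reach_keep_of_le (t - 4).zero_le).good h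
  have := (s.step_process t).degree_c hg
  rw [keep_c, (h.degree_keep _).1] at this
  omega

theorem Good.degree_process_of_ne (h : s.Good) (t : ℕ) {x : ℕ} (hx : x ≤ s.order)
    (hxc : x ≠ s.c) : (s.process t).degree x = s.degree x := by
  have hg : (s.keep (t - 4)).Good := (s.reach_keep_of_le (t - 4).zero_le).good h
  rw [(s.step_process t).degree_of_ne hg (by rw [keep_order]; omega) (by rwa [keep_c]),
    (h.degree_keep _).2.1 x hx hxc]

theorem Good.degree_process_new (h : s.Good) (t : ℕ) {x : ℕ} (hx : s.order < x)
    (hx' : x ≤ (s.process t).order) : (s.process t).degree x = 3 := by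
  have hg : (s.keep (t - 4)).Good := (s.reach_keep_of_le (t - 4).zero_le).good h
  have ho := s.keep_order (t - 4)
  have hc := s.keep_c (t - 4)
  have hcb := h.c_bounds
  rw [process_order] at hx'
  by_cases hxn : x = s.order + (t - 4) + 1
  · rw [hxn, ← ho, (s.step_process t).degree_new hg]
  · rw [(s.step_process t).degree_of_ne hg (by omega) (by omega),
      (h.degree_keep _).2.2 x hx (by omega)]

/-- After the first relabelling the old `a` has no label any more, so that during the processing of
an entry `a` is joined only to the first vertex inserted. -/
theorem Good.a_notMem_edges_process (h : s.Good) {t y : ℕ} (ht : 4 < t) (hy : s.order + 1 < y) :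
    s(s.a, y) ∉ (s.process t).edges := by
  have hs := s.step_keep_one
  have hac := hs.a_c_eq
  have hb := hs.b_eq
  have ho := hs.order_eq
  have hab := h.a_ne_b
  have hac' := h.a_ne_c
  have ha := h.a_bounds
  exact (s.reach_process_of_le (m := 1) (t := t) (by omega)).notMem_edges_of_unlabelled (hs.good h)
    (by omega) (by omega) (by omega) (by omega) (by omega)

theorem Good.a_process_c_mem_edges_iff (h : s.Good) {t : ℕ} (ht : 4 ≤ t) :
    s(s.a, (s.process t).c) ∈ (s.process t).edges ↔ t = 5 := by
  rcases (by omega : t = 4 ∨ t = 5 ∨ 5 < t) with rfl | rfl | ht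
  · exact iff_of_false ((s.step_process 4).a_b_notMem_edges h) (by decide)
  · refine iff_of_true ?_ rfl
    have hs := s.step_keep_one
    have hac := hs.a_c_eq
    have hb := hs.b_eq
    have ho := hs.order_eq
    have ha := h.a_bounds
    have hab := h.a_ne_b
    have hac' := h.a_ne_c
    rw [s.process_c_of_four_lt (by decide)]
    refine ((s.reach_process_of_le (m := 1) (t := 5) le_rfl).mem_edges_iff (hs.good h)
      (by omega) (by omega) ?_).2 ((hs.mem_edges h _).2 (Or.inr (Or.inl rfl)))
    simp only [ne_eq, Sym2.eq_iff]
    omega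
  · rw [s.process_c_of_four_lt (by omega)]
    exact iff_of_false (h.a_notMem_edges_process (by omega) (by omega)) (by omega)

theorem Good.a_process_b_mem_edges_iff (h : s.Good) {t : ℕ} (ht : 4 ≤ t) :
    s(s.a, (s.process t).b) ∈ (s.process t).edges ↔ t = 4 := by
  rw [process_b]
  rcases ht.eq_or_lt with rfl | ht
  · exact iff_of_true (((s.step_process 4).mem_edges h _).2 (Or.inr (Or.inl rfl))) rfl
  · exact iff_of_false (h.a_notMem_edges_process ht (by omega)) (by omega)

end

theorem reach_foldl (T : List ℕ) (s : Stage) : s.Reach (T.foldl process s) := by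
  induction T generalizing s with
  | nil => exact .refl
  | cons t T ih => exact (s.reach_process t).trans (ih _)

end Stage

/-! ### The stages between the entries -/

theorem reach_run_append (T T' : List ℕ) : (run T).Reach (run (T ++ T')) := by
  rw [run, run, List.foldl_append]
  exact Stage.reach_foldl _ _

theorem good_run (T : List ℕ) : (run T).Good := (Stage.reach_foldl T cube).good Stage.good_cube

theorem run_take_succ {T : List ℕ} {i : ℕ} (hi : i < T.length) :
    run (T.take (i + 1)) = (run (T.take i)).process T[i] := by
  rw [List.take_add_one, List.getElem?_eq_getElem hi, run, List.foldl_append]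
  rfl

theorem reach_run_take (T : List ℕ) {i j : ℕ} (h : i ≤ j) :
    (run (T.take i)).Reach (run (T.take j)) := by
  rw [← List.take_append_drop i (T.take j), List.take_take, min_eq_left h]
  exact reach_run_append _ _

theorem reach_run (T : List ℕ) (i : ℕ) : (run (T.take i)).Reach (run T) := by
  have := reach_run_append (T.take i) (T.drop i)
  rwa [List.take_append_drop] at this

theorem output_adj_iff {T : List ℕ} {x y : Vertex T} :
    (output T).Adj x y ↔ s(x.1, y.1) ∈ (run T).edges := by
  constructor
  · exact fun h => Stage.mem_edges.2 h.2
  · exact fun h => ⟨fun hxy => ((good_run T).proper _ _ h).2 (congrArg Subtype.val hxy),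
      Stage.mem_edges.1 h⟩

theorem output_degree_eq {T : List ℕ} (x : Vertex T) :
    (output T).degree x = (run T).degree x.1 := by
  rw [← SimpleGraph.card_neighborFinset_eq_degree,
    ← Finset.card_map (Function.Embedding.subtype _)]
  refine ((good_run T).degree_eq_card fun y => ?_).symm
  simp only [Finset.mem_map, SimpleGraph.mem_neighborFinset, output_adj_iff]
  constructor
  · rintro ⟨z, hz, rfl⟩
    exact hz
  · exact fun h => ⟨⟨y, Finset.mem_Icc.2 ((good_run T).proper_right h)⟩, h, rfl⟩

/-! ### The big vertices -/

section

variable {T : List ℕ}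

/-- The number of the `i`-th big vertex, entries of `T` being numbered from `0`. -/
def bigLabel (T : List ℕ) (i : ℕ) : ℕ := (run (T.take i)).c

theorem bigLabel_succ {i : ℕ} (hi : i < T.length) :
    bigLabel T (i + 1) = ((run (T.take i)).process T[i]).c := by
  rw [bigLabel, run_take_succ hi]

theorem bigLabel_le_order (T : List ℕ) (i : ℕ) : bigLabel T i ≤ (run (T.take i)).order :=
  (good_run _).c_bounds.2

theorem run_take_succ_a {i : ℕ} (hi : i < T.length) :
    (run (T.take (i + 1))).a = bigLabel T i := by
  rw [run_take_succ hi, Stage.process_a]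
  rfl

theorem order_lt_run_take_succ_b {i : ℕ} (hi : i < T.length) :
    (run (T.take i)).order < (run (T.take (i + 1))).b := by
  rw [run_take_succ hi, Stage.process_b]
  omega

/-- The vertex that is `c` two entries later has not been inserted yet. -/
theorem order_lt_bigLabel_add_two (hT : ∀ t ∈ T, 4 ≤ t) {i : ℕ} (hi : i + 1 < T.length) :
    (run (T.take i)).order < bigLabel T (i + 2) := by
  rw [bigLabel_succ hi]
  rcases (hT _ (List.getElem_mem hi)).eq_or_lt with h4 | h4
  · rw [← h4, Stage.process_four_c]
    exact order_lt_run_take_succ_b (by omega)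
  · have := (reach_run_take T (by omega : i ≤ i + 1)).order_le
    rw [Stage.process_c_of_four_lt _ h4]
    omega

theorem order_lt_bigLabel (hT : ∀ t ∈ T, 4 ≤ t) {i j : ℕ} (hij : i + 2 ≤ j) (hj : j ≤ T.length) :
    (run (T.take i)).order < bigLabel T j := by
  obtain ⟨k, rfl⟩ : ∃ k, j = k + 2 := ⟨j - 2, by omega⟩
  exact ((reach_run_take T (by omega : i ≤ k)).order_le).trans_lt
    (order_lt_bigLabel_add_two hT (by omega))

theorem bigLabel_ne (hT : ∀ t ∈ T, 4 ≤ t) {i j : ℕ} (hij : i < j) (hj : j ≤ T.length) :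
    bigLabel T i ≠ bigLabel T j := by
  rcases (by omega : j = i + 1 ∨ i + 2 ≤ j) with rfl | h
  · rw [← run_take_succ_a (by omega : i < T.length)]
    exact (good_run _).a_ne_c
  · have := order_lt_bigLabel hT h hj
    have := bigLabel_le_order T i
    omega

theorem degree_run_take (hT : ∀ t ∈ T, 4 ≤ t) {k : ℕ} (hk : k ≤ T.length) :
    (∀ (i : ℕ) (hi : i < k), (run (T.take k)).degree (bigLabel T i) = T[i]) ∧
    ∀ x, 1 ≤ x → x ≤ (run (T.take k)).order → (∀ i < k, x ≠ bigLabel T i) →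
      (run (T.take k)).degree x = 3 := by
  induction k with
  | zero =>
    have h : ∀ x ∈ Finset.Icc 1 4, cube.degree x = 3 := by decide
    exact ⟨fun i hi => by omega, fun x h1 h2 _ => h x (Finset.mem_Icc.2 ⟨h1, h2⟩)⟩
  | succ k ih =>
    obtain ⟨ih1, ih2⟩ := ih (by omega)
    have hg := good_run (T.take k)
    have h4 := hT _ (List.getElem_mem hk)
    rw [run_take_succ hk]
    refine ⟨fun i hi => ?_, fun x h1 h2 hx => ?_⟩
    · by_cases hik : i = k
      · subst hik
        have h3 := ih2 _ hg.c_bounds.1 hg.c_bounds.2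
          fun i' hi' => (bigLabel_ne hT hi' (by omega)).symm
        rw [bigLabel, hg.degree_process_c h4, h3]
        omega
      · have := (reach_run_take T (by omega : i ≤ k)).order_le
        rw [hg.degree_process_of_ne _ ((bigLabel_le_order T i).trans this)
          (bigLabel_ne hT (by omega) (by omega)), ih1 i (by omega)]
    · by_cases hxo : x ≤ (run (T.take k)).order
      · rw [hg.degree_process_of_ne _ hxo (hx k (by omega)),
          ih2 x h1 hxo fun i hi => hx i (by omega)]
      · exact hg.degree_process_new _ (by omega) h2

theorem bigLabel_edge_succ {i : ℕ} (hi : i + 1 < T.length) :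
    s(bigLabel T i, bigLabel T (i + 1)) ∈ (run T).edges := by
  have hg := good_run (T.take (i + 1))
  have := hg.b_ne_c
  have := hg.a_ne_c
  rw [← run_take_succ_a (by omega : i < T.length), bigLabel,
    (reach_run T (i + 1)).mem_edges_iff hg hg.a_bounds.2 hg.c_bounds.2
      (by simp only [ne_eq, Sym2.eq_iff]; omega)]
  exact hg.edge_ac

/-- At the end of the entry `T[i + 1]` the `i`-th big vertex is the old `a` and the `i + 2`-nd is the
new `c`.  The bound `h₁` is the one meant in `T[i + 1]`. -/
theorem bigLabel_edge_add_two_iff (hT : ∀ t ∈ T, 4 ≤ t) {i : ℕ} (h₁ : i + 1 < T.length)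
    (hi : i + 2 < T.length) :
    s(bigLabel T i, bigLabel T (i + 2)) ∈ (run T).edges ↔ T[i + 1] = 5 := by
  have hg := good_run (T.take (i + 2))
  have h1 := hg.a_ne_c
  have h2 := hg.b_ne_c
  have h3 : bigLabel T i ≤ (run (T.take (i + 2))).order :=
    (bigLabel_le_order T i).trans (reach_run_take T (by omega)).order_le
  rw [(reach_run T (i + 2)).mem_edges_iff hg h3 (bigLabel_le_order T _)
      (by simp only [bigLabel, ne_eq, Sym2.eq_iff]; omega),
    ← (good_run (T.take (i + 1))).a_process_c_mem_edges_iff (hT _ (List.getElem_mem _)),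
    ← bigLabel_succ, run_take_succ_a (by omega), ← run_take_succ]

/-- Two entries later, the `i`-th big vertex has lost its label. -/
theorem bigLabel_unlabelled (hT : ∀ t ∈ T, 4 ≤ t) {i : ℕ} (hi : i + 1 < T.length) :
    bigLabel T i ≠ (run (T.take (i + 2))).a ∧ bigLabel T i ≠ (run (T.take (i + 2))).b ∧
      bigLabel T i ≠ (run (T.take (i + 2))).c ∧
      bigLabel T i ≤ (run (T.take (i + 2))).order := by
  have h1 := bigLabel_le_order T i
  have h2 := (reach_run_take T (by omega : i ≤ i + 1)).order_le
  have h3 := (reach_run_take T (by omega : i ≤ i + 2)).order_le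
  have h4 : _ < (run (T.take (i + 2))).b := order_lt_run_take_succ_b hi
  refine ⟨?_, by omega, bigLabel_ne hT (by omega) (by omega), by omega⟩
  rw [run_take_succ_a hi]
  exact bigLabel_ne hT (by omega) (by omega)

/-- If `T[i + 2] = 4`, the `i + 3`-rd big vertex is the one labelled `b` at the end of the entry
`T[i + 1]`; otherwise it is inserted when the `i`-th big vertex has no label any more.  The bounds
`h₁` and `h₂` are those meant in `T[i + 1]` and `T[i + 2]`. -/
theorem bigLabel_edge_add_three_iff (hT : ∀ t ∈ T, 4 ≤ t) {i : ℕ} (h₁ : i + 1 < T.length)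
    (h₂ : i + 2 < T.length) (hi : i + 3 < T.length) :
    s(bigLabel T i, bigLabel T (i + 3)) ∈ (run T).edges ↔ T[i + 1] = 4 ∧ T[i + 2] = 4 := by
  have hg := good_run (T.take (i + 2))
  obtain ⟨ha, hb, hc, ho⟩ := bigLabel_unlabelled hT (by omega : i + 1 < T.length)
  have hr := reach_run T (i + 2)
  rw [bigLabel_succ (by omega : i + 2 < T.length)]
  rcases (hT _ (List.getElem_mem (by omega : i + 2 < T.length))).eq_or_lt with h4 | h4
  · rw [← h4, and_iff_left rfl, Stage.process_four_c,
      hr.mem_edges_iff hg ho hg.b_bounds.2 (by simp only [ne_eq, Sym2.eq_iff]; omega),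
      ← (good_run (T.take (i + 1))).a_process_b_mem_edges_iff (hT _ (List.getElem_mem _)),
      run_take_succ_a (by omega), ← run_take_succ]
  · rw [Stage.process_c_of_four_lt _ h4]
    exact iff_of_false (hr.notMem_edges_of_unlabelled hg ho ha hb hc (by omega)) (by omega)

theorem bigLabel_edge_far (hT : ∀ t ∈ T, 4 ≤ t) {i j : ℕ} (hij : i + 4 ≤ j) (hj : j < T.length) :
    s(bigLabel T i, bigLabel T j) ∉ (run T).edges := by
  obtain ⟨ha, hb, hc, ho⟩ := bigLabel_unlabelled hT (by omega : i + 1 < T.length)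
  exact (reach_run T (i + 2)).notMem_edges_of_unlabelled (good_run _) ho ha hb hc
    (order_lt_bigLabel hT (by omega) (by omega))

theorem bigLabel_edge_cases (hT : ∀ t ∈ T, 4 ≤ t) {i j : ℕ} (hij : i + 2 ≤ j) (hj : j < T.length)
    (h : s(bigLabel T i, bigLabel T j) ∈ (run T).edges) :
    (j = i + 2 ∧ T[i + 1] = 5) ∨ ∃ h3 : j = i + 3, T[i + 1] = 4 ∧ T[i + 2] = 4 := by
  rcases (by omega : j = i + 2 ∨ j = i + 3 ∨ i + 4 ≤ j) with rfl | rfl | h'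
  · exact Or.inl ⟨rfl, (bigLabel_edge_add_two_iff hT (by omega) hj).1 h⟩
  · exact Or.inr ⟨rfl, (bigLabel_edge_add_three_iff hT (by omega) (by omega) hj).1 h⟩
  · exact absurd h (bigLabel_edge_far hT h' hj)

end

end RadialAlgorithm

/-- For a tuple `T` of integers at least `4`, with `G = output T` and `u = bigVertex T`: the `u i` are
distinct, `u i` has degree `T[i]`, and all other vertices of `G` have degree `3`; `u i` is adjacent
to `u (i + 1)`; it is adjacent to at most one `u j` with `j ≥ i + 2`; this is `u (i + 2)` if and only
if `T[i + 1] = 5`, it is `u (i + 3)` if and only if `T[i + 1] = T[i + 2] = 4`, and in all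
other cases there is none. -/
theorem mainTheorem3 (T : List ℕ) (hT : ∀ t ∈ T, 4 ≤ t) :
    (Function.Injective (RadialAlgorithm.bigVertex T) ∧
      (∀ i : Fin T.length,
        (RadialAlgorithm.output T).degree (RadialAlgorithm.bigVertex T i) = T[i]) ∧
      (∀ x : RadialAlgorithm.Vertex T, x ∉ Set.range (RadialAlgorithm.bigVertex T) →
        (RadialAlgorithm.output T).degree x = 3)) ∧
    (∀ (i : ℕ) (hi : i + 1 < T.length),
      (RadialAlgorithm.output T).Adj
        (RadialAlgorithm.bigVertex T ⟨i, by omega⟩) (RadialAlgorithm.bigVertex T ⟨i + 1, hi⟩)) ∧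
    (∀ i j j' : Fin T.length, (i : ℕ) + 2 ≤ j → (i : ℕ) + 2 ≤ j' →
      (RadialAlgorithm.output T).Adj
        (RadialAlgorithm.bigVertex T i) (RadialAlgorithm.bigVertex T j) →
      (RadialAlgorithm.output T).Adj
        (RadialAlgorithm.bigVertex T i) (RadialAlgorithm.bigVertex T j') →
      j = j') ∧
    (∀ (i : ℕ) (hi : i + 2 < T.length),
      (RadialAlgorithm.output T).Adj
        (RadialAlgorithm.bigVertex T ⟨i, by omega⟩) (RadialAlgorithm.bigVertex T ⟨i + 2, hi⟩) ↔
      T[i + 1] = 5) ∧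
    (∀ (i : ℕ) (hi : i + 3 < T.length),
      (RadialAlgorithm.output T).Adj
        (RadialAlgorithm.bigVertex T ⟨i, by omega⟩) (RadialAlgorithm.bigVertex T ⟨i + 3, hi⟩) ↔
      T[i + 1] = 4 ∧ T[i + 2] = 4) ∧
    (∀ i : Fin T.length,
      ¬ (∃ _ : (i : ℕ) + 2 < T.length, T[(i : ℕ) + 1] = 5) →
      ¬ (∃ _ : (i : ℕ) + 3 < T.length, T[(i : ℕ) + 1] = 4 ∧ T[(i : ℕ) + 2] = 4) →
      ∀ j : Fin T.length, (i : ℕ) + 2 ≤ j →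
        ¬ (RadialAlgorithm.output T).Adj
          (RadialAlgorithm.bigVertex T i) (RadialAlgorithm.bigVertex T j)) := by
  have hadj (i j : Fin T.length) : (RadialAlgorithm.output T).Adj
      (RadialAlgorithm.bigVertex T i) (RadialAlgorithm.bigVertex T j) ↔
      s(RadialAlgorithm.bigLabel T i, RadialAlgorithm.bigLabel T j) ∈
        (RadialAlgorithm.run T).edges := RadialAlgorithm.output_adj_iff
  have hdeg := RadialAlgorithm.degree_run_take hT le_rfl
  rw [List.take_length] at hdeg
  simp only [hadj]
  refine ⟨⟨fun i j hij => ?_, fun i => ?_, fun x hx => ?_⟩, fun i hi => ?_,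
    fun i j j' hj hj' h h' => ?_, fun i hi => ?_, fun i hi => ?_, fun i h5 h4 j hj h => ?_⟩
  · have hij : RadialAlgorithm.bigLabel T i = RadialAlgorithm.bigLabel T j :=
      congrArg Subtype.val hij
    rcases lt_trichotomy i j with h | h | h
    · exact absurd hij (RadialAlgorithm.bigLabel_ne hT h j.2.le)
    · exact h
    · exact absurd hij.symm (RadialAlgorithm.bigLabel_ne hT h i.2.le)
  · rw [RadialAlgorithm.output_degree_eq]
    exact hdeg.1 i i.2
  · rw [RadialAlgorithm.output_degree_eq]
    have hb := Finset.mem_Icc.1 x.2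
    exact hdeg.2 x.1 hb.1 hb.2 fun i hi h => hx ⟨⟨i, hi⟩, Subtype.ext h.symm⟩
  · exact RadialAlgorithm.bigLabel_edge_succ hi
  · have c := RadialAlgorithm.bigLabel_edge_cases hT hj j.2 h
    have c' := RadialAlgorithm.bigLabel_edge_cases hT hj' j'.2 h'
    apply Fin.ext
    rcases c with ⟨c1, c2⟩ | ⟨c1, c2, -⟩ <;> rcases c' with ⟨d1, d2⟩ | ⟨d1, d2, -⟩ <;> omega
  · exact RadialAlgorithm.bigLabel_edge_add_two_iff hT (by omega) hi
  · exact RadialAlgorithm.bigLabel_edge_add_three_iff hT (by omega) (by omega) hi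
  · rcases RadialAlgorithm.bigLabel_edge_cases hT hj j.2 h with ⟨c1, c2⟩ | ⟨c1, c2⟩
    · exact h5 ⟨c1 ▸ j.2, c2⟩
    · exact h4 ⟨c1 ▸ j.2, c2⟩
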